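/- Let $\Omega$ be a Polish space with its Borel $\sigma$-algebra $\mathcal F$, let $d,T\ge 0$ be integers and let $S=(S_t)_{t=0}^T$ be a family of Borel measurable maps $S_t:\Omega\to\mathbb R^d$, with increments $\Delta S_t=S_t-S_{t-1}$ and natural filtration $\mathcal F_t=\sigma(S_0,\dots,S_t)$. Let $\mathcal M$ be the set of probability measures on $(\Omega,\mathcal F)$ under which $S$ is an $(\mathcal F_t)$-martingale. For $H=(H_t)_{t=1}^T$ with $H_t:\Omega\to\mathbb R^d$ put $V_0(H)=0$, $V_t(H)=\sum_{s=1}^t H_s\cdot\Delta S_s$ and $\mathcal V^+_H=\{\omega: V_T(H)(\omega)>0\}$. *Separation.* For $D\subseteq\mathbb R^d$ let $D^{cc}$ be the convex cone generated by $\mathrm{conv}(D)$, together with $0$; let $\mathrm{ri}$ denote the relative interior. For $K\subseteq\mathbb R^d$ let $V_K=\{v:\|v\|=1,\ v\cdot y\ge 0\ \forall y\in K\}$. For every $K$ with $V_K\ne\varnothing$ fix a dense sequence $(v_n)_{n\ge1}$ in $V_K$, and call $\sum_{n\ge1}2^{-(n-1)}v_n$ the standard separator of $K$. For $1\le t\le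 T$ and $\Gamma\subseteq\Omega$ put $A^0=\Gamma$ and, as long as $0\notin\mathrm{ri}\,(\Delta S_t(A^{i-1}))^{cc}$, let $H^i$ be the standard separator of $(\Delta S_t(A^{i-1}))^{cc}$, $B^i=\{\omega\in A^{i-1}: H^i\cdot\Delta S_t(\omega)>0\}$ and $A^i=A^{i-1}\setminus B^i$. This stops after $\beta\le d$ steps; put $B^*=\Gamma\setminus\bigcup_{i=1}^\beta B^i$. *Backward elimination.* For $z=(z_0,\dots,z_T)\in(\mathbb R^d)^{T+1}$ let $\Sigma^z_{t-1}=\{\omega: S_s(\omega)=z_s,\ 0\le s\le t-1\}$. Put $\Omega_T=\Omega$ and, for $t=T,\dots,1$, $\widetilde\Sigma^z_{t-1}=\Omega_t\cap\Sigma^z_{t-1}$ and $$\Omega_{t-1}=\Omega_t\setminus\bigcup_z\{\Sigma^z_{t-1}: 0\notin\mathrm{conv}(\Delta S_t(\widetilde\Sigma^z_{t-1}))\}.$$ Let $\beta_{t,z},H^i_{t,z},B^i_{t,z},B^*_{t,z}$ be the objects above for $\Gamma=\widetilde\Sigma^z_{t-1}$, and let $\Omega_*=\bigcap_{t=1}^T\bigcup_z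 B^*_{t,z}$. *Universal Arbitrage Aggregator.* Define $H^\bullet_t(\omega)=H^i_{t,z}$ if $\omega\in B^i_{t,z}$ for some $1\le i\le\beta_{t,z}$, where $z=(S_0(\omega),\dots,S_T(\omega))$, and $H^\bullet_t(\omega)=0$ otherwise. Let $\widetilde{\mathcal F}_t=\mathcal F_t\vee\sigma(H^\bullet_1,\dots,H^\bullet_{t+1})$ for $t<T$, $\widetilde{\mathcal F}_T=\mathcal F_T\vee\sigma(H^\bullet_1,\dots,H^\bullet_T)$, let $\widetilde{\mathcal H}$ be the set of all $H$ such that each $H_t$ is $\widetilde{\mathcal F}_{t-1}$-measurable, and let $$\widetilde{\mathcal H}^+=\{H\in\widetilde{\mathcal H}: V_T(H)(\omega)\ge 0\ \forall\omega\in\Omega,\ V_0(H)=0\}.$$ **Proposition.** (1) $\mathcal V^+_{H^\bullet}=\bigcup_{H\in\widetilde{\mathcal H}^+}\mathcal V^+_H=(\Omega_*)^c$. (2) $\mathcal M\ne\varnothing$ if and only if $\bigcup_{H\in\widetilde{\mathcal H}^+}\mathcal V^+_H$ is strictly contained in $\Omega$. -/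

import Mathlib

open Set MeasureTheory

namespace RobustMarket

noncomputable section

/-! ### Prices, value process, martingale measures -/

/-- The state space of the vector of the `d` (discounted) risky prices. -/
abbrev E (d : ℕ) : Type := EuclideanSpace ℝ (Fin d)

/-- The price increment over the period that starts at time `t` and ends at time `t + 1`,
where `t` runs through `0, …, T - 1`. -/
def increment {Ω : Type*} {d T : ℕ} (S : Fin (T + 1) → Ω → E d) (t : Fin T) (ω : Ω) : E d :=
  S t.succ ω - S t.castSucc ω

/-- The value at time `u` of the strategy `H` with zero initial cost; `H t` is the position
held over the period from `t` to `t + 1`, i.e. `H t` stands for the usual `H_{t+1}`. -/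
def value {Ω : Type*} {d T : ℕ} (S : Fin (T + 1) → Ω → E d) (H : Fin T → Ω → E d)
    (u : Fin (T + 1)) (ω : Ω) : ℝ :=
  ∑ t : Fin T with t.castSucc < u, inner ℝ (H t ω) (increment S t ω)

/-- The set where the terminal value of `H` is positive. -/
def gainSet {Ω : Type*} {d T : ℕ} (S : Fin (T + 1) → Ω → E d) (H : Fin T → Ω → E d) : Set Ω :=
  {ω | 0 < value S H (Fin.last T) ω}

/-- The natural filtration of the price process. -/
def priceFiltration {Ω : Type*} [MeasurableSpace Ω] {d T : ℕ} (S : Fin (T + 1) → Ω → E d)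
    (hS : ∀ u, Measurable (S u)) : Filtration (Fin (T + 1)) ‹MeasurableSpace Ω› :=
  Filtration.natural S fun u => (hS u).stronglyMeasurable

/-- The probability measures under which the price process is a martingale in its natural
filtration. -/
def martingaleMeasures {Ω : Type*} [MeasurableSpace Ω] {d T : ℕ} (S : Fin (T + 1) → Ω → E d)
    (hS : ∀ u, Measurable (S u)) : Set (Measure Ω) :=
  {Q | IsProbabilityMeasure Q ∧ Martingale S (priceFiltration S hS) Q}

/-! ### Convex cones and standard separators -/

/-- The convex cone with vertex at the origin generated by a set `D`: the cone generated by the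
convex hull of `D`, together with `0`. -/
def coneOf {d : ℕ} (D : Set (E d)) : Set (E d) :=
  insert 0 (ConvexCone.hull ℝ (convexHull ℝ D) : Set (E d))

/-- The unit vectors that are nonnegative on `K`. -/
def unitSeparators {d : ℕ} (K : Set (E d)) : Set (E d) :=
  {v | ‖v‖ = 1 ∧ ∀ y ∈ K, 0 ≤ inner ℝ v y}

/-- `v` lists, for every set `K` that has a unit separator, a dense sequence of unit separators
of `K`. -/
def IsSeparatorFamily {d : ℕ} (v : Set (E d) → ℕ → E d) : Prop :=
  ∀ K : Set (E d), (unitSeparators K).Nonempty →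
    (∀ n, v K n ∈ unitSeparators K) ∧ unitSeparators K ⊆ closure (range (v K))

theorem exists_isSeparatorFamily (d : ℕ) :
    ∃ v : Set (E d) → ℕ → E d, IsSeparatorFamily v := by
  have h : ∀ K : Set (E d), ∃ w : ℕ → E d, (unitSeparators K).Nonempty →
      (∀ n, w n ∈ unitSeparators K) ∧ unitSeparators K ⊆ closure (range w) := by
    intro K
    by_cases hK : (unitSeparators K).Nonempty
    · have : Nonempty (unitSeparators K) := hK.to_subtype
      refine ⟨fun n => (TopologicalSpace.denseSeq (unitSeparators K) n : E d), fun _ =>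
        ⟨fun n => (TopologicalSpace.denseSeq (unitSeparators K) n).2, ?_⟩⟩
      have hd := Subtype.dense_iff.1 (TopologicalSpace.denseRange_denseSeq (unitSeparators K))
      rwa [← range_comp] at hd
    · exact ⟨fun _ => 0, fun hK' => absurd hK' hK⟩
  choose v hv using h
  exact ⟨v, hv⟩

/-- The standard separator of `K`: the sum over `n = 0, 1, …` of `2 ^ (-n)` times the `n`-th
vector of the chosen dense sequence. -/
def standardSeparator {d : ℕ} (v : Set (E d) → ℕ → E d) (K : Set (E d)) : E d :=
  ∑' n : ℕ, ((1 : ℝ) / 2 ^ n) • v K n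

/-! ### The successive separation of a set of scenarios over one period -/

/-- What is left of `Γ` after `n` separation steps in period `t`. -/
def residual {Ω : Type*} {d T : ℕ} (v : Set (E d) → ℕ → E d) (S : Fin (T + 1) → Ω → E d)
    (t : Fin T) (Γ : Set Ω) : ℕ → Set Ω
  | 0 => Γ
  | n + 1 => residual v S t Γ n \
      {ω | 0 < inner ℝ (standardSeparator v (coneOf (increment S t '' residual v S t Γ n)))
        (increment S t ω)}

/-- The separator used in step `n + 1`, usually denoted `H^{n+1}`. -/
def separator {Ω : Type*} {d T : ℕ} (v : Set (E d) → ℕ → E d) (S : Fin (T + 1) → Ω → E d)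
    (t : Fin T) (Γ : Set Ω) (n : ℕ) : E d :=
  standardSeparator v (coneOf (increment S t '' residual v S t Γ n))

/-- The set split off in step `n + 1`, usually denoted `B^{n+1}`. -/
def block {Ω : Type*} {d T : ℕ} (v : Set (E d) → ℕ → E d) (S : Fin (T + 1) → Ω → E d)
    (t : Fin T) (Γ : Set Ω) (n : ℕ) : Set Ω :=
  {ω ∈ residual v S t Γ n | 0 < inner ℝ (separator v S t Γ n) (increment S t ω)}

/-- The number `β` of separation steps: the procedure stops as soon as `0` is in the relative
interior of the cone generated by the remaining increments. Every step before that lowers the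
dimension of the cone, so that this happens after at most `d` steps. -/
def numSteps {Ω : Type*} {d T : ℕ} (v : Set (E d) → ℕ → E d) (S : Fin (T + 1) → Ω → E d)
    (t : Fin T) (Γ : Set Ω) : ℕ :=
  sInf {n | (0 : E d) ∈ intrinsicInterior ℝ (coneOf (increment S t '' residual v S t Γ n))}

/-- The set `B^*` that remains when the procedure stops. -/
def core {Ω : Type*} {d T : ℕ} (v : Set (E d) → ℕ → E d) (S : Fin (T + 1) → Ω → E d)
    (t : Fin T) (Γ : Set Ω) : Set Ω :=
  Γ \ ⋃ i ∈ Finset.range (numSteps v S t Γ), block v S t Γ i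

/-- The position equal to `H^i` on `B^i` for `i = 1, …, β`, and to `0` elsewhere. -/
def stepPosition {Ω : Type*} {d T : ℕ} (v : Set (E d) → ℕ → E d) (S : Fin (T + 1) → Ω → E d)
    (t : Fin T) (Γ : Set Ω) (ω : Ω) : E d :=
  ∑ i ∈ Finset.range (numSteps v S t Γ),
    (block v S t Γ i).indicator (fun _ => separator v S t Γ i) ω

/-! ### Level sets, backward elimination, and the set `Ω_*` -/

/-- The scenarios whose prices up to and including time `u` agree with the trajectory `z`. -/
def levelSet {Ω : Type*} {d T : ℕ} (S : Fin (T + 1) → Ω → E d) (u : Fin (T + 1))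
    (z : Fin (T + 1) → E d) : Set Ω :=
  {ω | ∀ s ≤ u, S s ω = z s}

/-- The backward iteration `Ω_T = Ω`, and `Ω_t` is obtained from `Ω_{t+1}` by removing all level
sets of `(S_0, …, S_t)` on which `0` is not in the convex hull of the next increments that are
possible within `Ω_{t+1}`. -/
def survivors {Ω : Type*} {d T : ℕ} (S : Fin (T + 1) → Ω → E d) (u : Fin (T + 1)) : Set Ω :=
  Fin.reverseInduction (motive := fun _ => Set Ω) univ
    (fun t Ωnext => Ωnext \ ⋃ z ∈ {z : Fin (T + 1) → E d |
        (0 : E d) ∉ convexHull ℝ (increment S t '' (Ωnext ∩ levelSet S t.castSucc z))},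
      levelSet S t.castSucc z) u

theorem survivors_last {Ω : Type*} {d T : ℕ} (S : Fin (T + 1) → Ω → E d) :
    survivors S (Fin.last T) = univ := by
  simp [survivors]

theorem survivors_castSucc {Ω : Type*} {d T : ℕ} (S : Fin (T + 1) → Ω → E d) (t : Fin T) :
    survivors S t.castSucc = survivors S t.succ \ ⋃ z ∈ {z : Fin (T + 1) → E d |
        (0 : E d) ∉ convexHull ℝ
          (increment S t '' (survivors S t.succ ∩ levelSet S t.castSucc z))},
      levelSet S t.castSucc z := by
  simp only [survivors, Fin.reverseInduction_castSucc]

/-- The part of the level set of `z` at time `t` that lies in `Ω_{t+1}`. -/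
def reducedLevelSet {Ω : Type*} {d T : ℕ} (S : Fin (T + 1) → Ω → E d) (t : Fin T)
    (z : Fin (T + 1) → E d) : Set Ω :=
  survivors S t.succ ∩ levelSet S t.castSucc z

/-- The set `Ω_*`. -/
def efficientSet {Ω : Type*} {d T : ℕ} (v : Set (E d) → ℕ → E d)
    (S : Fin (T + 1) → Ω → E d) : Set Ω :=
  ⋂ t : Fin T, ⋃ z : Fin (T + 1) → E d, core v S t (reducedLevelSet S t z)

/-! ### The Universal Arbitrage Aggregator and the enlarged filtration -/

/-- The Universal Arbitrage Aggregator; `universalAggregator v S t` is the position over the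
period from `t` to `t + 1`. -/
def universalAggregator {Ω : Type*} {d T : ℕ} (v : Set (E d) → ℕ → E d)
    (S : Fin (T + 1) → Ω → E d) (t : Fin T) (ω : Ω) : E d :=
  stepPosition v S t (reducedLevelSet S t fun s => S s ω) ω

/-- The enlarged filtration: at time `u < T` it is generated by the natural filtration and the
positions of the aggregator over all periods that start at or before time `u`; at time `T` by
the natural filtration and all positions of the aggregator. -/
abbrev enlargedFiltration {Ω : Type*} [MeasurableSpace Ω] {d T : ℕ} (v : Set (E d) → ℕ → E d)
    (S : Fin (T + 1) → Ω → E d) (hS : ∀ u, Measurable (S u)) (u : Fin (T + 1)) :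
    MeasurableSpace Ω :=
  priceFiltration S hS u ⊔
    ⨆ s : Fin T, ⨆ _ : s.castSucc ≤ u,
      MeasurableSpace.comap (universalAggregator v S s) inferInstance

/-- The strategies that are predictable for the enlarged filtration. -/
def enlargedStrategies {Ω : Type*} [MeasurableSpace Ω] {d T : ℕ} (v : Set (E d) → ℕ → E d)
    (S : Fin (T + 1) → Ω → E d) (hS : ∀ u, Measurable (S u)) : Set (Fin T → Ω → E d) :=
  {H | ∀ t : Fin T, Measurable[enlargedFiltration v S hS t.castSucc] (H t)}

/-- Those of them that have zero initial value and a terminal value that is nonnegative in every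
scenario. -/
def nonnegStrategies {Ω : Type*} [MeasurableSpace Ω] {d T : ℕ} (v : Set (E d) → ℕ → E d)
    (S : Fin (T + 1) → Ω → E d) (hS : ∀ u, Measurable (S u)) : Set (Fin T → Ω → E d) :=
  {H ∈ enlargedStrategies v S hS |
    (∀ ω, 0 ≤ value S H (Fin.last T) ω) ∧ ∀ ω, value S H 0 ω = 0}

end

end RobustMarket

namespace RobustMarket

/-! ### Convex cones, relative interiors and separation at the origin. -/

section Cone

variable {d : ℕ} {D : Set (E d)}

/-! The heart is a description of `efficientSet` node by node: the increments occurring at one of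
its nodes are exactly those of the core there (`image_increment_efficientNode`), so `0` lies in the
relative interior of the cone they generate. This rests on branching: cores are determined by
increments, so a scenario may be exchanged for any core scenario of its current node and then
continued to the end (`mem_core_of_branch`, `exists_mem_efficientSet`).

The aggregator never loses, and it gains in any period whose scenario set contains the scenario
while the core does not; such a period exists exactly off `efficientSet`. On `efficientSet` the
aggregator vanishes, so strategies of the enlarged filtration are constant on its nodes. Their
values there are nonnegative by backward induction, then zero by forward induction, since `0` in the
relative interior excludes one-sided gains.

Given a point of `efficientSet`, mixing Dirac measures backwards, with the weights of a convex
combination equal to `0`, yields a finitely supported martingale measure. Conversely, under a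
martingale measure the conditional law given past prices has mean increment zero, so it is carried
by the core. Hence almost every scenario survives the elimination, and branching produces a point of
`efficientSet`. -/

theorem subset_coneOf (D : Set (E d)) : D ⊆ coneOf D :=
  ((subset_convexHull ℝ D).trans ConvexCone.subset_hull).trans (subset_insert _ _)

theorem mem_coneOf {x : E d} :
    x ∈ coneOf D ↔ x = 0 ∨ ∃ r : ℝ, 0 < r ∧ ∃ y ∈ convexHull ℝ D, r • y = x := by
  simp only [coneOf, mem_insert_iff, SetLike.mem_coe,
    ConvexCone.mem_hull_of_convex (convex_convexHull ℝ D), Set.mem_smul_set]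

theorem convex_coneOf (D : Set (E d)) : Convex ℝ (coneOf D) := by
  intro x hx y hy a b ha hb hab
  rcases hx with rfl | hx
  · rcases hy with rfl | hy
    · simp [coneOf]
    · rcases hb.eq_or_lt with rfl | hb
      · simp [coneOf]
      · simpa [coneOf] using Or.inr (ConvexCone.smul_mem _ hb hy)
  · rcases hy with rfl | hy
    · rcases ha.eq_or_lt with rfl | ha
      · simp [coneOf]
      · simpa [coneOf] using Or.inr (ConvexCone.smul_mem _ ha hx)
    · exact Or.inr (ConvexCone.convex _ hx hy ha hb hab)

theorem inner_nonneg_of_mem_convexHull {h : E d} (hh : ∀ y ∈ D, 0 ≤ inner ℝ h y) {y : E d}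
    (hy : y ∈ convexHull ℝ D) : 0 ≤ inner ℝ h y := by
  have hc : Convex ℝ {y : E d | 0 ≤ inner ℝ h y} :=
    convex_halfSpace_ge (innerₛₗ ℝ h).isLinear 0
  exact convexHull_min hh hc hy

theorem inner_nonneg_of_mem_coneOf {h : E d} (hh : ∀ y ∈ D, 0 ≤ inner ℝ h y) {y : E d}
    (hy : y ∈ coneOf D) : 0 ≤ inner ℝ h y := by
  obtain rfl | ⟨r, hr, z, hz, rfl⟩ := mem_coneOf.1 hy
  · simp
  · rw [inner_smul_right]
    exact mul_nonneg hr.le (inner_nonneg_of_mem_convexHull hh hz)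

theorem coneOf_subset_span (D : Set (E d)) : coneOf D ⊆ Submodule.span ℝ D := by
  intro x hx
  obtain rfl | ⟨r, -, y, hy, rfl⟩ := mem_coneOf.1 hx
  · exact Submodule.zero_mem _
  · exact Submodule.smul_mem _ _
      (convexHull_min Submodule.subset_span (Submodule.convex _) hy)

theorem affineSpan_coneOf (D : Set (E d)) :
    (affineSpan ℝ (coneOf D) : Set (E d)) = Submodule.span ℝ D := by
  rw [show coneOf D = insert 0 (coneOf D) by simp [coneOf], affineSpan_insert_zero]
  exact congrArg _ (le_antisymm (Submodule.span_le.2 (coneOf_subset_span D))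
    (Submodule.span_mono (subset_coneOf D)))

theorem zero_mem_intrinsicInterior_coneOf :
    (0 : E d) ∈ intrinsicInterior ℝ (coneOf D) ↔
      ∃ ε > 0, ∀ y ∈ Submodule.span ℝ D, ‖y‖ < ε → y ∈ coneOf D := by
  have hmem : ∀ y, y ∈ affineSpan ℝ (coneOf D) ↔ y ∈ Submodule.span ℝ D := fun y => by
    rw [← SetLike.mem_coe, affineSpan_coneOf, SetLike.mem_coe]
  rw [mem_intrinsicInterior]
  constructor
  · rintro ⟨⟨y, hy⟩, hint, rfl⟩
    obtain ⟨ε, hε, hb⟩ := Metric.mem_nhds_iff.1 (mem_interior_iff_mem_nhds.1 hint)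
    refine ⟨ε, hε, fun y hy hyε => ?_⟩
    have := @hb ⟨y, (hmem y).2 hy⟩ (by
      rw [Metric.mem_ball, Subtype.dist_eq]
      simpa using hyε)
    exact this
  · rintro ⟨ε, hε, hb⟩
    refine ⟨⟨0, (hmem 0).2 (Submodule.zero_mem _)⟩, ?_, rfl⟩
    rw [mem_interior_iff_mem_nhds, Metric.mem_nhds_iff]
    refine ⟨ε, hε, ?_⟩
    rintro ⟨y, hy⟩ hyε
    rw [Metric.mem_ball, Subtype.dist_eq] at hyε
    exact hb y ((hmem y).1 hy) (by simpa using hyε)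

/-- Proper separation of a convex cone from its vertex. -/
theorem exists_separator_of_notMem_intrinsicInterior
    (h0 : (0 : E d) ∉ intrinsicInterior ℝ (coneOf D)) :
    ∃ v : E d, ‖v‖ = 1 ∧ (∀ y ∈ D, 0 ≤ inner ℝ v y) ∧ ∃ y ∈ D, 0 < inner ℝ v y := by
  -- Inside the span of `D` the cone has nonempty interior, so Hahn–Banach gives a functional
  -- strictly negative on that interior; strictness makes the separation proper.
  set W := Submodule.span ℝ D with hW
  set K : Set W := Subtype.val ⁻¹' coneOf D with hK
  have hKc : Convex ℝ K := (convex_coneOf D).linear_preimage W.subtype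
  have hK0 : (0 : W) ∉ interior K := by
    intro hint
    obtain ⟨ε, hε, hb⟩ := Metric.mem_nhds_iff.1 (mem_interior_iff_mem_nhds.1 hint)
    refine h0 (zero_mem_intrinsicInterior_coneOf.2 ⟨ε, hε, fun y hy hyε => ?_⟩)
    exact @hb ⟨y, hy⟩ (by simpa using hyε)
  have hne : (interior K).Nonempty := by
    rw [hKc.interior_nonempty_iff_affineSpan_eq_top]
    have hins : insert 0 K = K := insert_eq_of_mem (by simp [hK, coneOf])
    rw [← hins, ← SetLike.coe_set_eq, affineSpan_insert_zero]
    have : Submodule.span ℝ K = ⊤ := by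
      rw [eq_top_iff, ← Submodule.span_span_coe_preimage]
      exact Submodule.span_mono fun y hy => subset_coneOf D hy
    rw [this]
    simp
  obtain ⟨f, hf⟩ := geometric_hahn_banach_open_point hKc.interior isOpen_interior hK0
  rw [map_zero] at hf
  have hf' : ∀ y ∈ K, f y ≤ 0 := by
    intro y hy
    have hy' : y ∈ closure (interior K) := by
      rw [hKc.closure_interior_eq_closure_of_nonempty_interior hne]
      exact subset_closure hy
    exact closure_minimal (fun a ha => (hf a ha).le)
      (isClosed_le f.continuous continuous_const) hy'
  set u : W := -((InnerProductSpace.toDual ℝ W).symm f) with hu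
  have hinner : ∀ y : W, inner ℝ (u : E d) (y : E d) = -f y := fun y => by
    rw [← Submodule.coe_inner, hu, inner_neg_left, InnerProductSpace.toDual_symm_apply]
  obtain ⟨a, ha⟩ := hne
  have hfa := hf a ha
  have hu0 : (u : E d) ≠ 0 := by
    intro h
    have := hinner a
    rw [h, inner_zero_left] at this
    linarith
  have hpos : 0 < ‖(u : E d)‖⁻¹ := inv_pos.2 (norm_pos_iff.2 hu0)
  have hnonneg : ∀ y ∈ D, 0 ≤ inner ℝ (u : E d) y := fun y hy => by
    have := hf' ⟨y, Submodule.subset_span hy⟩ (subset_coneOf D hy)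
    rw [hinner ⟨y, Submodule.subset_span hy⟩]
    linarith
  refine ⟨‖(u : E d)‖⁻¹ • (u : E d), norm_smul_inv_norm hu0, fun y hy => ?_, ?_⟩
  · rw [real_inner_smul_left]
    exact mul_nonneg hpos.le (hnonneg y hy)
  · by_contra! hcon
    -- Otherwise `u` would annihilate the whole span of `D`, including the interior point `a`, where
    -- `f a < 0`.
    have hzero : D ⊆ LinearMap.ker (innerₛₗ ℝ (u : E d)) := fun y hy => by
      have h1 := hcon y hy
      rw [real_inner_smul_left] at h1
      have h2 : inner ℝ (u : E d) y ≤ 0 := by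
        by_contra! h
        exact absurd (mul_pos hpos h) (not_lt.2 h1)
      simpa using le_antisymm h2 (hnonneg y hy)
    have := Submodule.span_le.2 hzero a.2
    have h3 : inner ℝ (u : E d) (a : E d) = 0 := by simpa using this
    rw [hinner] at h3
    linarith

theorem exists_neg_smul_mem_coneOf
    (h0 : (0 : E d) ∈ intrinsicInterior ℝ (coneOf D)) {y : E d} (hy : y ∈ D) :
    ∃ δ : ℝ, 0 < δ ∧ (-δ) • y ∈ coneOf D := by
  obtain ⟨ε, hε, hb⟩ := zero_mem_intrinsicInterior_coneOf.1 h0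
  -- The `+ 1` covers `y = 0` and keeps the norm of the multiple strictly below `ε`.
  refine ⟨ε / (‖y‖ + 1), by positivity,
    hb _ (Submodule.smul_mem _ _ (Submodule.subset_span hy)) ?_⟩
  rw [norm_smul, norm_neg, Real.norm_of_nonneg (by positivity), div_mul_eq_mul_div,
    div_lt_iff₀ (by positivity)]
  nlinarith

theorem inner_eq_zero_of_zero_mem_intrinsicInterior
    (h0 : (0 : E d) ∈ intrinsicInterior ℝ (coneOf D)) {h : E d}
    (hh : ∀ y ∈ D, 0 ≤ inner ℝ h y) {y : E d} (hy : y ∈ D) : inner ℝ h y = 0 := by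
  obtain ⟨δ, hδ, hmem⟩ := exists_neg_smul_mem_coneOf h0 hy
  have h1 := inner_nonneg_of_mem_coneOf hh hmem
  rw [inner_smul_right] at h1
  have h2 := hh y hy
  nlinarith

theorem zero_mem_convexHull_of_zero_mem_intrinsicInterior
    (h0 : (0 : E d) ∈ intrinsicInterior ℝ (coneOf D)) (hD : D.Nonempty) :
    (0 : E d) ∈ convexHull ℝ D := by
  obtain ⟨y, hy⟩ := hD
  obtain ⟨δ, hδ, hmem⟩ := exists_neg_smul_mem_coneOf h0 hy
  have hy' := subset_convexHull ℝ D hy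
  obtain h | ⟨r, hr, z, hz, hrz⟩ := mem_coneOf.1 hmem
  · have : y = 0 := by simpa [hδ.ne'] using h
    rwa [this] at hy'
  -- Since `r • z = (-δ) • y`, these weights balance `y` and `z` to `0`.
  · have := convex_convexHull ℝ D hy' hz (a := δ / (δ + r)) (b := r / (δ + r))
      (by positivity) (by positivity) (by field_simp)
    convert this using 1
    rw [div_eq_inv_mul, div_eq_inv_mul, mul_smul, mul_smul, hrz, ← smul_add]
    simp

/-- In a convex combination equal to `0`, the weighted inner products with `h` are nonnegative and
sum to zero, so every point with nonzero weight is orthogonal to `h`. -/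
theorem zero_mem_convexHull_inter_of_inner_nonneg {h : E d} (hh : ∀ y ∈ D, 0 ≤ inner ℝ h y)
    (h0 : (0 : E d) ∈ convexHull ℝ D) :
    (0 : E d) ∈ convexHull ℝ {y ∈ D | inner ℝ h y = 0} := by
  obtain ⟨ι, _, w, z, hw, hw1, hz, hsum⟩ := mem_convexHull_iff_exists_fintype.1 h0
  have hzero : ∀ i, w i * inner ℝ h (z i) = 0 := by
    have h1 : ∑ i, w i * inner ℝ h (z i) = 0 := by
      have := congrArg (inner ℝ h) hsum
      simpa [inner_sum, inner_smul_right] using this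
    have h2 := (Finset.sum_eq_zero_iff_of_nonneg
      fun i _ => mul_nonneg (hw i) (hh _ (hz i))).1 h1
    exact fun i => h2 i (Finset.mem_univ i)
  rw [← hsum, ← finsum_eq_sum_of_fintype]
  rw [← finsum_eq_sum_of_fintype] at hw1
  exact (convex_convexHull ℝ _).finsum_mem hw hw1 fun i hi =>
    subset_convexHull ℝ _ ⟨hz i, (mul_eq_zero.1 (hzero i)).resolve_left hi⟩

end Cone

/-! ### Standard separators separate properly. -/

section Separator

variable {d : ℕ} {v : Set (E d) → ℕ → E d} {D : Set (E d)}

theorem hasSum_inner_standardSeparator (hv : IsSeparatorFamily v) {K : Set (E d)}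
    (hK : (unitSeparators K).Nonempty) (y : E d) :
    HasSum (fun n : ℕ => (1 / 2 ^ n : ℝ) * inner ℝ (v K n) y)
      (inner ℝ (standardSeparator v K) y) := by
  have hs : Summable fun n : ℕ => ((1 : ℝ) / 2 ^ n) • v K n := by
    refine Summable.of_norm ?_
    have : (fun n : ℕ => ‖((1 : ℝ) / 2 ^ n) • v K n‖) = fun n => (1 / 2 : ℝ) ^ n := by
      ext n
      rw [norm_smul, ((hv K hK).1 n).1, mul_one, Real.norm_of_nonneg (by positivity), one_div_pow]
    rw [this]
    exact summable_geometric_two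
  have := hs.hasSum.mapL (innerSL ℝ y)
  simpa [standardSeparator, inner_smul_right, real_inner_comm] using this

theorem inner_standardSeparator_nonneg (hv : IsSeparatorFamily v)
    (h0 : (0 : E d) ∉ intrinsicInterior ℝ (coneOf D)) {y : E d} (hy : y ∈ D) :
    0 ≤ inner ℝ (standardSeparator v (coneOf D)) y := by
  obtain ⟨u, hu1, hu, -⟩ := exists_separator_of_notMem_intrinsicInterior h0
  have hK : (unitSeparators (coneOf D)).Nonempty :=
    ⟨u, hu1, fun y hy => inner_nonneg_of_mem_coneOf hu hy⟩
  exact (hasSum_inner_standardSeparator hv hK y).nonneg fun n =>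
    mul_nonneg (by positivity) (((hv _ hK).1 n).2 y (subset_coneOf D hy))

/-- Density is used here: strict positivity at `y` is an open condition on the separator, so a
proper separator passes it to some term of the sequence, and no other term of the series is negative
at `y`. -/
theorem exists_inner_standardSeparator_pos (hv : IsSeparatorFamily v)
    (h0 : (0 : E d) ∉ intrinsicInterior ℝ (coneOf D)) :
    ∃ y ∈ D, 0 < inner ℝ (standardSeparator v (coneOf D)) y := by
  obtain ⟨u, hu1, hu, y, hy, huy⟩ := exists_separator_of_notMem_intrinsicInterior h0
  have huK : u ∈ unitSeparators (coneOf D) :=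
    ⟨hu1, fun y hy => inner_nonneg_of_mem_coneOf hu hy⟩
  refine ⟨y, hy, ?_⟩
  have hopen : IsOpen {w : E d | 0 < inner ℝ w y} :=
    isOpen_lt continuous_const (continuous_id.inner continuous_const)
  obtain ⟨w, hw, n, rfl⟩ := mem_closure_iff.1 ((hv _ ⟨u, huK⟩).2 huK) _ hopen huy
  have hsum := hasSum_inner_standardSeparator hv ⟨u, huK⟩ y
  have hterm : ∀ n, 0 ≤ (1 / 2 ^ n : ℝ) * inner ℝ (v (coneOf D) n) y := fun n =>
    mul_nonneg (by positivity) (((hv _ ⟨u, huK⟩).1 n).2 y (subset_coneOf D hy))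
  refine lt_of_lt_of_le ?_ (le_hasSum hsum n fun m _ => hterm m)
  exact mul_pos (by positivity) hw

end Separator

/-! ### Successive separation over one period. -/

section Procedure

variable {Ω : Type*} {d T : ℕ} {v : Set (E d) → ℕ → E d} {S : Fin (T + 1) → Ω → E d}
  {t : Fin T} {Γ : Set Ω}

theorem residual_succ (v : Set (E d) → ℕ → E d) (S : Fin (T + 1) → Ω → E d) (t : Fin T)
    (Γ : Set Ω) (n : ℕ) :
    residual v S t Γ (n + 1) =
      residual v S t Γ n \ {ω | 0 < inner ℝ (separator v S t Γ n) (increment S t ω)} := rfl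

theorem residual_antitone (v : Set (E d) → ℕ → E d) (S : Fin (T + 1) → Ω → E d) (t : Fin T)
    (Γ : Set Ω) : Antitone (residual v S t Γ) :=
  antitone_nat_of_succ_le fun _ => sdiff_subset

theorem separator_inner_nonneg (hv : IsSeparatorFamily v) {n : ℕ}
    (h0 : (0 : E d) ∉ intrinsicInterior ℝ (coneOf (increment S t '' residual v S t Γ n)))
    {ω : Ω} (hω : ω ∈ residual v S t Γ n) :
    0 ≤ inner ℝ (separator v S t Γ n) (increment S t ω) :=
  inner_standardSeparator_nonneg hv h0 (mem_image_of_mem _ hω)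

theorem mem_residual_succ_iff (hv : IsSeparatorFamily v) {n : ℕ}
    (h0 : (0 : E d) ∉ intrinsicInterior ℝ (coneOf (increment S t '' residual v S t Γ n)))
    {ω : Ω} : ω ∈ residual v S t Γ (n + 1) ↔
      ω ∈ residual v S t Γ n ∧ inner ℝ (separator v S t Γ n) (increment S t ω) = 0 := by
  rw [residual_succ, mem_sdiff, mem_ofPred_eq, not_lt]
  exact and_congr_right fun h =>
    ⟨fun h' => le_antisymm h' (separator_inner_nonneg hv h0 h), fun h' => h'.le⟩

/-- Each step taken before stopping lowers the dimension of the span: the new residual lies in the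
hyperplane orthogonal to the separator, while the old one does not. -/
theorem exists_zero_mem_intrinsicInterior (hv : IsSeparatorFamily v) (S : Fin (T + 1) → Ω → E d)
    (t : Fin T) (Γ : Set Ω) :
    ∃ n, (0 : E d) ∈ intrinsicInterior ℝ (coneOf (increment S t '' residual v S t Γ n)) := by
  by_contra! h
  have hdim : ∀ n, Module.finrank ℝ
      (Submodule.span ℝ (increment S t '' residual v S t Γ n)) + n ≤ d := by
    intro n
    induction n with
    | zero =>
      simpa using (Submodule.span ℝ (increment S t '' residual v S t Γ 0)).finrank_le
    | succ n ih =>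
      have hlt : Submodule.span ℝ (increment S t '' residual v S t Γ (n + 1)) <
          Submodule.span ℝ (increment S t '' residual v S t Γ n) := by
        refine lt_of_le_of_ne
          (Submodule.span_mono (image_mono (residual_antitone v S t Γ n.le_succ))) fun heq => ?_
        have hker : Submodule.span ℝ (increment S t '' residual v S t Γ (n + 1)) ≤
            LinearMap.ker (innerₛₗ ℝ (separator v S t Γ n)) := by
          rw [Submodule.span_le]
          rintro _ ⟨ω, hω, rfl⟩
          simpa using ((mem_residual_succ_iff hv (h n)).1 hω).2
        obtain ⟨y, hy, hpos⟩ := exists_inner_standardSeparator_pos hv (h n)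
        have hy0 := (heq ▸ hker) (Submodule.subset_span hy)
        exact hpos.ne' (by simpa [separator] using hy0)
      have := Submodule.finrank_lt_finrank_of_lt hlt
      omega
  have := hdim (d + 1)
  omega

theorem zero_mem_intrinsicInterior_numSteps (hv : IsSeparatorFamily v)
    (S : Fin (T + 1) → Ω → E d) (t : Fin T) (Γ : Set Ω) :
    (0 : E d) ∈ intrinsicInterior ℝ
      (coneOf (increment S t '' residual v S t Γ (numSteps v S t Γ))) :=
  Nat.sInf_mem (exists_zero_mem_intrinsicInterior hv S t Γ)

theorem zero_notMem_intrinsicInterior_of_lt {n : ℕ} (hn : n < numSteps v S t Γ) :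
    (0 : E d) ∉ intrinsicInterior ℝ (coneOf (increment S t '' residual v S t Γ n)) :=
  Nat.notMem_of_lt_sInf hn

theorem core_eq_residual (v : Set (E d) → ℕ → E d) (S : Fin (T + 1) → Ω → E d) (t : Fin T)
    (Γ : Set Ω) : core v S t Γ = residual v S t Γ (numSteps v S t Γ) := by
  have h : ∀ n, Γ \ ⋃ i ∈ Finset.range n, block v S t Γ i = residual v S t Γ n := by
    intro n
    induction n with
    | zero => simp [residual]
    | succ n ih =>
      rw [residual_succ, Finset.range_add_one, Finset.set_biUnion_insert, union_comm, ← sdiff_sdiff,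
        ih]
      ext ω
      simp only [block, mem_sdiff, mem_ofPred_eq, not_and]
      exact and_congr_right fun h => ⟨fun h' => h' h, fun h' _ => h'⟩
  exact h _

theorem core_subset : core v S t Γ ⊆ Γ := sdiff_subset

theorem zero_mem_intrinsicInterior_core (hv : IsSeparatorFamily v)
    (S : Fin (T + 1) → Ω → E d) (t : Fin T) (Γ : Set Ω) :
    (0 : E d) ∈ intrinsicInterior ℝ (coneOf (increment S t '' core v S t Γ)) := by
  rw [core_eq_residual]
  exact zero_mem_intrinsicInterior_numSteps hv S t Γ

/-- A property that holds initially and passes from each residual to the next holds of the core. -/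
theorem core_induction {p : Set Ω → Prop} (h0 : p Γ)
    (hstep : ∀ n < numSteps v S t Γ, p (residual v S t Γ n) → p (residual v S t Γ (n + 1))) :
    p (core v S t Γ) := by
  rw [core_eq_residual]
  have h : ∀ n ≤ numSteps v S t Γ, p (residual v S t Γ n) := by
    intro n
    induction n with
    | zero => exact fun _ => h0
    | succ n ih => exact fun hn => hstep n hn (ih (Nat.le_of_succ_le hn))
  exact h _ le_rfl

/-- Links the convex-hull test of the backward elimination to the one-period procedure: a separation
step removes only points that cannot carry weight in a combination equal to `0`. -/
theorem zero_mem_convexHull_iff_core_nonempty (hv : IsSeparatorFamily v) :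
    (0 : E d) ∈ convexHull ℝ (increment S t '' Γ) ↔ (core v S t Γ).Nonempty := by
  constructor
  · intro h
    have : (0 : E d) ∈ convexHull ℝ (increment S t '' core v S t Γ) := by
      refine core_induction (p := fun A => (0 : E d) ∈ convexHull ℝ (increment S t '' A)) h
        fun n hn ih => ?_
      have h0 := zero_notMem_intrinsicInterior_of_lt hn
      refine convexHull_mono ?_ (zero_mem_convexHull_inter_of_inner_nonneg
        (fun y hy => inner_standardSeparator_nonneg hv h0 hy) ih)
      rintro _ ⟨⟨ω, hω, rfl⟩, hzero⟩
      exact mem_image_of_mem _ ((mem_residual_succ_iff hv h0).2 ⟨hω, hzero⟩)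
    simpa using convexHull_nonempty_iff.1 ⟨_, this⟩
  · intro h
    exact convexHull_mono (image_mono core_subset)
      (zero_mem_convexHull_of_zero_mem_intrinsicInterior
        (zero_mem_intrinsicInterior_core hv S t Γ) (h.image _))

theorem mem_core_of_increment_eq {ω ω' : Ω} (hω : ω ∈ core v S t Γ) (hω' : ω' ∈ Γ)
    (h : increment S t ω' = increment S t ω) : ω' ∈ core v S t Γ := by
  revert hω
  refine core_induction (p := fun A => ω ∈ A → ω' ∈ A) (fun _ => hω') fun n _ ih hn => ?_
  rw [residual_succ] at hn ⊢
  exact ⟨ih hn.1, by simpa only [mem_ofPred_eq, h] using hn.2⟩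

theorem stepPosition_of_mem_core {ω : Ω} (hω : ω ∈ core v S t Γ) :
    stepPosition v S t Γ ω = 0 := by
  refine Finset.sum_eq_zero fun i hi => indicator_of_notMem (fun h => hω.2 ?_) _
  exact mem_biUnion (Finset.mem_coe.2 hi) h

/-- Blocks are defined by strict positivity, so gains can be bounded term by term without
disjointness of the blocks. -/
theorem inner_stepPosition_term_nonneg (i : ℕ) (ω : Ω) :
    0 ≤ inner ℝ ((block v S t Γ i).indicator (fun _ => separator v S t Γ i) ω)
      (increment S t ω) := by
  by_cases h : ω ∈ block v S t Γ i
  · rw [indicator_of_mem h]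
    exact h.2.le
  · rw [indicator_of_notMem h, inner_zero_left]

theorem inner_stepPosition_nonneg (ω : Ω) :
    0 ≤ inner ℝ (stepPosition v S t Γ ω) (increment S t ω) := by
  rw [stepPosition, sum_inner]
  exact Finset.sum_nonneg fun i _ => inner_stepPosition_term_nonneg i ω

theorem inner_stepPosition_pos {ω : Ω} (hω : ω ∈ Γ) (hω' : ω ∉ core v S t Γ) :
    0 < inner ℝ (stepPosition v S t Γ ω) (increment S t ω) := by
  have : ω ∈ ⋃ i ∈ Finset.range (numSteps v S t Γ), block v S t Γ i := by
    by_contra h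
    exact hω' ⟨hω, h⟩
  obtain ⟨i, hi, hb⟩ := mem_iUnion₂.1 this
  rw [stepPosition, sum_inner]
  refine Finset.sum_pos' (fun i _ => inner_stepPosition_term_nonneg i ω) ⟨i, hi, ?_⟩
  rw [indicator_of_mem hb]
  exact hb.2

end Procedure

/-! ### Backward elimination, branching and the nodes of `efficientSet`. -/

section Survivors

variable {Ω : Type*} {d T : ℕ} {v : Set (E d) → ℕ → E d} {S : Fin (T + 1) → Ω → E d}

/-- The set that is processed at time `t` in the scenario `ω`. -/
def scenarioSet (S : Fin (T + 1) → Ω → E d) (t : Fin T) (ω : Ω) : Set Ω :=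
  reducedLevelSet S t fun s => S s ω

/-- The elimination at time `t` keeps the scenario `ω`. -/
def IsViable (S : Fin (T + 1) → Ω → E d) (t : Fin T) (ω : Ω) : Prop :=
  (0 : E d) ∈ convexHull ℝ (increment S t '' scenarioSet S t ω)

theorem levelSet_congr {u : Fin (T + 1)} {z z' : Fin (T + 1) → E d}
    (h : ∀ s ≤ u, z s = z' s) : levelSet S u z = levelSet S u z' := by
  ext ω
  exact forall₂_congr fun s hs => by rw [h s hs]

theorem scenarioSet_congr {t : Fin T} {ω ω' : Ω} (h : ∀ s ≤ t.castSucc, S s ω' = S s ω) :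
    scenarioSet S t ω' = scenarioSet S t ω := by
  rw [scenarioSet, scenarioSet, reducedLevelSet, reducedLevelSet, levelSet_congr h]

theorem reducedLevelSet_eq_scenarioSet {t : Fin T} {z : Fin (T + 1) → E d} {ω : Ω}
    (h : ω ∈ reducedLevelSet S t z) : reducedLevelSet S t z = scenarioSet S t ω := by
  rw [scenarioSet, reducedLevelSet, reducedLevelSet, levelSet_congr fun s hs => (h.2 s hs).symm]

theorem mem_survivors_castSucc {t : Fin T} {ω : Ω} :
    ω ∈ survivors S t.castSucc ↔ ω ∈ survivors S t.succ ∧ IsViable S t ω := by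
  rw [survivors_castSucc, mem_sdiff]
  refine and_congr_right fun _ => ?_
  rw [← not_iff_comm]
  simp only [mem_iUnion₂, mem_ofPred_eq]
  constructor
  · exact fun h => ⟨_, h, fun s _ => rfl⟩
  · rintro ⟨z, hz, hω⟩
    rwa [IsViable, scenarioSet, reducedLevelSet, levelSet_congr hω]

theorem mem_survivors {u : Fin (T + 1)} {ω : Ω} :
    ω ∈ survivors S u ↔ ∀ t : Fin T, u ≤ t.castSucc → IsViable S t ω := by
  induction u using Fin.reverseInduction with
  | last => simp [survivors_last]
  | cast t ih =>
    rw [mem_survivors_castSucc, ih]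
    constructor
    · rintro ⟨h, ht⟩ s hs
      rcases (Fin.castSucc_le_castSucc_iff.1 hs).eq_or_lt with rfl | hlt
      · exact ht
      · exact h s (Fin.succ_le_castSucc_iff.2 hlt)
    · exact fun h => ⟨fun s hs => h s ((Fin.castSucc_lt_succ).le.trans hs), h t le_rfl⟩

theorem isViable_congr {t : Fin T} {ω ω' : Ω} (h : ∀ s ≤ t.castSucc, S s ω' = S s ω) :
    IsViable S t ω' ↔ IsViable S t ω := by
  rw [IsViable, scenarioSet_congr h, IsViable]

theorem isViable_iff (hv : IsSeparatorFamily v) {t : Fin T} {ω : Ω} :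
    IsViable S t ω ↔ (core v S t (scenarioSet S t ω)).Nonempty :=
  zero_mem_convexHull_iff_core_nonempty hv

theorem mem_efficientSet {ω : Ω} :
    ω ∈ efficientSet v S ↔ ∀ t : Fin T, ω ∈ core v S t (scenarioSet S t ω) := by
  simp only [efficientSet, mem_iInter, mem_iUnion]
  refine forall_congr' fun t => ⟨?_, fun h => ⟨_, h⟩⟩
  rintro ⟨z, hz⟩
  rwa [← reducedLevelSet_eq_scenarioSet (core_subset hz)]

/-- Branching: a scenario that is not eliminated in the past may be replaced, at the node of time
`t`, by any scenario of the core of that node. -/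
theorem mem_core_of_branch {t : Fin T} {ω ω₁ : Ω}
    (hω : ω ∈ survivors S t.castSucc)
    (hpast : ∀ s < t, ω ∈ core v S s (scenarioSet S s ω))
    (hω₁ : ω₁ ∈ core v S t (scenarioSet S t ω)) :
    ∀ s ≤ t, ω₁ ∈ core v S s (scenarioSet S s ω₁) := by
  have hsame : ∀ s ≤ t.castSucc, S s ω₁ = S s ω := (core_subset hω₁).2
  intro s hst
  have hs : ∀ r ≤ s.castSucc, S r ω₁ = S r ω := fun r hr =>
    hsame r (hr.trans (Fin.castSucc_le_castSucc_iff.2 hst))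
  rw [scenarioSet_congr hs]
  rcases hst.eq_or_lt with rfl | hst
  · exact hω₁
  have hst' : s.succ ≤ t.castSucc := Fin.succ_le_castSucc_iff.2 hst
  -- In an earlier period both scenarios have the same increment, so only survival is at stake:
  -- viability up to time `t` comes from `ω`, later viability from `ω₁`.
  refine mem_core_of_increment_eq (hpast s hst) ⟨mem_survivors.2 fun r hr => ?_, hs⟩ ?_
  · rcases le_or_gt r t with hrt | hrt
    · rw [isViable_congr fun q hq => hsame q (hq.trans (Fin.castSucc_le_castSucc_iff.2 hrt))]
      exact mem_survivors.1 (core_subset (hpast s hst)).1 r hr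
    · exact mem_survivors.1 (core_subset hω₁).1 r (Fin.succ_le_castSucc_iff.2 hrt)
  · rw [increment, increment, hsame _ hst', hsame _ (Fin.castSucc_lt_succ.le.trans hst')]

/-- Viability makes the core at the current node nonempty; moving to one of its scenarios keeps the
earlier core conditions and advances time by one. -/
theorem exists_mem_efficientSet (hv : IsSeparatorFamily v) {u : Fin (T + 1)} {ω : Ω}
    (hω : ω ∈ survivors S u)
    (hpast : ∀ s : Fin T, s.castSucc < u → ω ∈ core v S s (scenarioSet S s ω)) :
    ∃ ω' ∈ efficientSet v S, ∀ s ≤ u, S s ω' = S s ω := by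
  induction u using Fin.reverseInduction generalizing ω with
  | last => exact ⟨ω, mem_efficientSet.2 fun t => hpast t (Fin.castSucc_lt_last t), fun _ _ => rfl⟩
  | cast t ih =>
    obtain ⟨ω₁, hω₁⟩ := (isViable_iff hv).1 (mem_survivors_castSucc.1 hω).2
    obtain ⟨ω', hω', h⟩ := ih (core_subset hω₁).1 fun s hs =>
      mem_core_of_branch hω (fun s hs => hpast s (Fin.castSucc_lt_castSucc_iff.2 hs)) hω₁ s
        (Fin.castSucc_lt_succ_iff.1 hs)
    exact ⟨ω', hω', fun s hs => (h s (hs.trans Fin.castSucc_lt_succ.le)).trans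
      ((core_subset hω₁).2 s hs)⟩

/-- The scenarios of `Ω_*` that agree with `ω` up to time `t`. -/
def efficientNode (v : Set (E d) → ℕ → E d) (S : Fin (T + 1) → Ω → E d) (t : Fin T) (ω : Ω) :
    Set Ω :=
  {ω' ∈ efficientSet v S | ∀ s ≤ t.castSucc, S s ω' = S s ω}

/-- A core scenario need not itself lie in `efficientSet`, but branching continues it to one that
does without changing prices through the end of the period. -/
theorem image_increment_efficientNode (hv : IsSeparatorFamily v) {ω : Ω}
    (hω : ω ∈ efficientSet v S) (t : Fin T) :
    increment S t '' efficientNode v S t ω = increment S t '' core v S t (scenarioSet S t ω) := by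
  have hω' := mem_efficientSet.1 hω
  apply Subset.antisymm
  · rintro _ ⟨ω', ⟨h, hs⟩, rfl⟩
    refine mem_image_of_mem _ ?_
    rw [← scenarioSet_congr hs]
    exact mem_efficientSet.1 h t
  · rintro _ ⟨ω₁, hω₁, rfl⟩
    have hsurv : ω ∈ survivors S t.castSucc :=
      mem_survivors_castSucc.2 ⟨(core_subset (hω' t)).1, (isViable_iff hv).2 ⟨_, hω' t⟩⟩
    obtain ⟨ω', h, hs⟩ := exists_mem_efficientSet hv (core_subset hω₁).1 fun s hs =>
      mem_core_of_branch hsurv (fun s _ => hω' s) hω₁ s (Fin.castSucc_lt_succ_iff.1 hs)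
    refine ⟨ω', ⟨h, fun s hst => ?_⟩, ?_⟩
    · exact (hs s (hst.trans Fin.castSucc_lt_succ.le)).trans ((core_subset hω₁).2 s hst)
    · rw [increment, increment, hs _ le_rfl, hs _ Fin.castSucc_lt_succ.le]

theorem zero_mem_convexHull_efficientNode (hv : IsSeparatorFamily v) {ω : Ω}
    (hω : ω ∈ efficientSet v S) (t : Fin T) :
    (0 : E d) ∈ convexHull ℝ (increment S t '' efficientNode v S t ω) := by
  rw [image_increment_efficientNode hv hω]
  exact zero_mem_convexHull_of_zero_mem_intrinsicInterior
    (zero_mem_intrinsicInterior_core hv S t _)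
    ⟨_, mem_image_of_mem _ (mem_efficientSet.1 hω t)⟩

theorem inner_increment_eq_zero (hv : IsSeparatorFamily v) {ω : Ω}
    (hω : ω ∈ efficientSet v S) {t : Fin T} {h : E d}
    (hh : ∀ ω' ∈ efficientNode v S t ω, 0 ≤ inner ℝ h (increment S t ω')) :
    inner ℝ h (increment S t ω) = 0 := by
  refine inner_eq_zero_of_zero_mem_intrinsicInterior
    (D := increment S t '' efficientNode v S t ω) ?_ (forall_mem_image.2 hh)
    (mem_image_of_mem _ ⟨hω, fun _ _ => rfl⟩)
  rw [image_increment_efficientNode hv hω]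
  exact zero_mem_intrinsicInterior_core hv S t _

end Survivors

/-! ### Measurability as constancy on scenarios with a common past. -/

section Indistinguishable

variable {Ω : Type*}

/-- The `σ`-algebra of the sets that do not separate `ω` from `ω'`. -/
@[reducible]
def indistinguishableSpace (ω ω' : Ω) : MeasurableSpace Ω where
  MeasurableSet' A := ω ∈ A ↔ ω' ∈ A
  measurableSet_empty := by simp
  measurableSet_compl A h := by simpa using not_congr h
  measurableSet_iUnion f h := by
    simp only [mem_iUnion]
    exact exists_congr h

theorem comap_le_indistinguishableSpace {β : Type*} [MeasurableSpace β] {f : Ω → β} {ω ω' : Ω}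
    (h : f ω = f ω') : MeasurableSpace.comap f inferInstance ≤ indistinguishableSpace ω ω' := by
  rintro _ ⟨B, -, rfl⟩
  change ω ∈ f ⁻¹' B ↔ ω' ∈ f ⁻¹' B
  rw [mem_preimage, mem_preimage, h]

variable [MeasurableSpace Ω] {d T : ℕ} {v : Set (E d) → ℕ → E d} {S : Fin (T + 1) → Ω → E d}

theorem priceFiltration_le_indistinguishableSpace (hS : ∀ u, Measurable (S u))
    {u : Fin (T + 1)} {ω ω' : Ω} (h : ∀ s ≤ u, S s ω = S s ω') :
    (priceFiltration S hS u : MeasurableSpace Ω) ≤ indistinguishableSpace ω ω' :=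
  iSup₂_le fun s hs => comap_le_indistinguishableSpace (h s hs)

theorem enlargedFiltration_le_indistinguishableSpace (hS : ∀ u, Measurable (S u))
    {u : Fin (T + 1)} {ω ω' : Ω} (h : ∀ s ≤ u, S s ω = S s ω')
    (h' : ∀ s : Fin T, universalAggregator v S s ω = universalAggregator v S s ω') :
    enlargedFiltration v S hS u ≤ indistinguishableSpace ω ω' :=
  sup_le (priceFiltration_le_indistinguishableSpace hS h)
    (iSup₂_le fun s _ => comap_le_indistinguishableSpace (h' s))

end Indistinguishable

/-! ### Gains of the aggregator and of nonnegative strategies. -/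

section Arbitrage

variable {Ω : Type*} {d T : ℕ} {v : Set (E d) → ℕ → E d} {S : Fin (T + 1) → Ω → E d}

theorem universalAggregator_of_mem_efficientSet {ω : Ω} (hω : ω ∈ efficientSet v S) (t : Fin T) :
    universalAggregator v S t ω = 0 :=
  stepPosition_of_mem_core (mem_efficientSet.1 hω t)

theorem value_last (H : Fin T → Ω → E d) (ω : Ω) :
    value S H (Fin.last T) ω = ∑ t, inner ℝ (H t ω) (increment S t ω) := by
  simp [value, Fin.castSucc_lt_last]

theorem value_zero (H : Fin T → Ω → E d) (ω : Ω) : value S H 0 ω = 0 := by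
  simp [value]

theorem value_succ (H : Fin T → Ω → E d) (t : Fin T) (ω : Ω) :
    value S H t.succ ω =
      value S H t.castSucc ω + inner ℝ (H t ω) (increment S t ω) := by
  have : Finset.univ.filter (fun s : Fin T => s.castSucc < t.succ) =
      insert t (Finset.univ.filter fun s : Fin T => s.castSucc < t.castSucc) := by
    ext s
    simp [Fin.castSucc_lt_succ_iff, le_iff_eq_or_lt]
  rw [value, this, Finset.sum_insert (by simp), add_comm, value]

theorem gainSet_universalAggregator (hv : IsSeparatorFamily v) (S : Fin (T + 1) → Ω → E d) :
    gainSet S (universalAggregator v S) = (efficientSet v S)ᶜ := by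
  ext ω
  rw [gainSet, mem_ofPred_eq, value_last, mem_compl_iff, ← not_iff_not, not_not]
  constructor
  · intro h
    by_contra hω
    refine h ?_
    obtain ⟨t, hmem, hcore⟩ : ∃ t : Fin T, ω ∈ scenarioSet S t ω ∧
        ω ∉ core v S t (scenarioSet S t ω) := by
      -- If no such period existed, backward induction would show that `ω` is never eliminated, and
      -- then that it lies in every core.
      by_contra! hcon
      refine hω (mem_efficientSet.2 fun t => hcon t ⟨?_, fun _ _ => rfl⟩)
      have hall : ∀ u, ω ∈ survivors S u := fun u => by
        induction u using Fin.reverseInduction with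
        | last => rw [survivors_last]; trivial
        | cast t ih =>
          exact mem_survivors_castSucc.2
            ⟨ih, (isViable_iff hv).2 ⟨ω, hcon t ⟨ih, fun _ _ => rfl⟩⟩⟩
      exact hall _
    exact Finset.sum_pos' (fun t _ => inner_stepPosition_nonneg ω)
      ⟨t, Finset.mem_univ t, inner_stepPosition_pos hmem hcore⟩
  · intro h
    simp [universalAggregator_of_mem_efficientSet h]

variable [MeasurableSpace Ω]

theorem universalAggregator_mem_nonnegStrategies (v : Set (E d) → ℕ → E d)
    (hS : ∀ u, Measurable (S u)) :
    universalAggregator v S ∈ nonnegStrategies v S hS := by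
  refine ⟨fun t => ?_, fun ω => ?_, value_zero _⟩
  · exact (comap_measurable _).mono
      (le_sup_of_le_right (le_iSup₂_of_le t le_rfl le_rfl)) le_rfl
  · rw [value_last]
    exact Finset.sum_nonneg fun t _ => inner_stepPosition_nonneg ω

/-- The aggregator is zero on `efficientSet`, so there the enlarged filtration distinguishes no more
scenarios than past prices do. -/
theorem strategy_eq_of_mem_efficientNode {hS : ∀ u, Measurable (S u)} {H : Fin T → Ω → E d}
    (hH : H ∈ enlargedStrategies v S hS) {t : Fin T} {ω ω' : Ω} (hω : ω ∈ efficientSet v S)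
    (hω' : ω' ∈ efficientNode v S t ω) {s : Fin T} (hs : s ≤ t) : H s ω' = H s ω := by
  have h := enlargedFiltration_le_indistinguishableSpace (v := v) hS (u := s.castSucc)
    (fun r hr => hω'.2 r (hr.trans (Fin.castSucc_le_castSucc_iff.2 hs))) (fun s => by
      rw [universalAggregator_of_mem_efficientSet hω'.1,
        universalAggregator_of_mem_efficientSet hω])
    _ (hH s (measurableSet_singleton (H s ω)))
  exact h.2 rfl

theorem value_eq_of_mem_efficientNode {hS : ∀ u, Measurable (S u)} {H : Fin T → Ω → E d}
    (hH : H ∈ enlargedStrategies v S hS) {t : Fin T} {ω ω' : Ω} (hω : ω ∈ efficientSet v S)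
    (hω' : ω' ∈ efficientNode v S t ω) :
    value S H t.castSucc ω' = value S H t.castSucc ω := by
  refine Finset.sum_congr rfl fun s hs => ?_
  have hst : s < t := by simpa using hs
  rw [strategy_eq_of_mem_efficientNode hH hω hω' hst.le, increment, increment,
    hω'.2 _ (Fin.succ_le_castSucc_iff.2 hst),
    hω'.2 _ (Fin.castSucc_le_castSucc_iff.2 hst.le)]

theorem value_succ_of_mem_efficientNode {hS : ∀ u, Measurable (S u)} {H : Fin T → Ω → E d}
    (hH : H ∈ enlargedStrategies v S hS) {t : Fin T} {ω ω' : Ω} (hω : ω ∈ efficientSet v S)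
    (hω' : ω' ∈ efficientNode v S t ω) :
    value S H t.succ ω' =
      value S H t.castSucc ω + inner ℝ (H t ω) (increment S t ω') := by
  rw [value_succ, value_eq_of_mem_efficientNode hH hω hω',
    strategy_eq_of_mem_efficientNode hH hω hω' le_rfl]

/-- Along `Ω_*` the value process of a strategy with nonnegative terminal value is nonnegative. -/
theorem value_nonneg_of_mem_efficientSet (hv : IsSeparatorFamily v) {hS : ∀ u, Measurable (S u)}
    {H : Fin T → Ω → E d} (hH : H ∈ nonnegStrategies v S hS) (u : Fin (T + 1)) :
    ∀ ω ∈ efficientSet v S, 0 ≤ value S H u ω := by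
  induction u using Fin.reverseInduction with
  | last => exact fun ω _ => hH.2.1 ω
  | cast t ih =>
    intro ω hω
    have hc : Convex ℝ {y : E d | 0 ≤ value S H t.castSucc ω + inner ℝ (H t ω) y} := by
      simpa only [neg_le_iff_add_nonneg', innerₛₗ_apply_apply] using
        convex_halfSpace_ge (innerₛₗ ℝ (H t ω)).isLinear (-value S H t.castSucc ω)
    -- The next value is affine in the increment and nonnegative over the node; evaluating at `0`, a
    -- point of the convex hull, leaves the current value.
    have := convexHull_min (by
      rintro _ ⟨ω', hω', rfl⟩
      rw [mem_ofPred_eq, ← value_succ_of_mem_efficientNode hH.1 hω hω']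
      exact ih ω' hω'.1) hc (zero_mem_convexHull_efficientNode hv hω t)
    simpa using this

theorem value_eq_zero_of_mem_efficientSet (hv : IsSeparatorFamily v) {hS : ∀ u, Measurable (S u)}
    {H : Fin T → Ω → E d} (hH : H ∈ nonnegStrategies v S hS) {ω : Ω} (hω : ω ∈ efficientSet v S)
    (u : Fin (T + 1)) : value S H u ω = 0 := by
  induction u using Fin.induction with
  | zero => exact value_zero H ω
  | succ t ih =>
    rw [value_succ, ih, zero_add]
    refine inner_increment_eq_zero hv hω fun ω' hω' => ?_
    have := value_nonneg_of_mem_efficientSet hv hH t.succ ω' hω'.1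
    rwa [value_succ_of_mem_efficientNode hH.1 hω hω', ih, zero_add] at this

theorem iUnion_gainSet_nonnegStrategies (hv : IsSeparatorFamily v) (hS : ∀ u, Measurable (S u)) :
    ⋃ H ∈ nonnegStrategies v S hS, gainSet S H = (efficientSet v S)ᶜ := by
  apply Subset.antisymm
  · refine iUnion₂_subset fun H hH ω hω hmem => ?_
    have hpos : 0 < value S H (Fin.last T) ω := hω
    exact hpos.ne' (value_eq_zero_of_mem_efficientSet hv hH hmem _)
  · rw [← gainSet_universalAggregator hv]
    exact subset_biUnion_of_mem (u := fun H => gainSet S H)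
      (universalAggregator_mem_nonnegStrategies v hS)

end Arbitrage

/-! ### Existence of martingale measures. -/

section MartingaleMeasure

variable {Ω : Type*} [MeasurableSpace Ω] {d T : ℕ} {v : Set (E d) → ℕ → E d}
  {S : Fin (T + 1) → Ω → E d}

theorem mem_martingaleMeasures_of_setIntegral_increment_eq_zero (hS : ∀ u, Measurable (S u))
    {Q : Measure Ω} [IsProbabilityMeasure Q] (hint : ∀ u, Integrable (S u) Q)
    (h : ∀ (t : Fin T) (A : Set Ω), MeasurableSet[priceFiltration S hS t.castSucc] A →
      ∫ ω, A.indicator (increment S t) ω ∂Q = 0) :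
    Q ∈ martingaleMeasures S hS := by
  refine ⟨inferInstance, Filtration.stronglyAdapted_natural _, fun i j hij => ?_⟩
  have hset : ∀ A : Set Ω, MeasurableSet[priceFiltration S hS i] A →
      i ≤ j → ∫ ω in A, S i ω ∂Q = ∫ ω in A, S j ω ∂Q := by
    intro A hA
    clear hij
    induction j using Fin.induction with
    | zero => exact fun hij => by rw [Fin.le_zero_iff.1 hij]
    | succ t ih =>
      intro hit
      rcases hit.eq_or_lt with rfl | hlt
      · rfl
      have hit' : i ≤ t.castSucc := Fin.le_castSucc_iff.2 hlt
      have hA' := (priceFiltration S hS).mono hit' A hA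
      have h0 := h t A hA'
      rw [integral_indicator ((priceFiltration S hS).le _ _ hA')] at h0
      simp only [increment] at h0
      rw [integral_sub (hint _).integrableOn (hint _).integrableOn, sub_eq_zero] at h0
      rw [ih hit', h0]
  exact (ae_eq_condExp_of_forall_setIntegral_eq ((priceFiltration S hS).le i) (hint j)
    (fun _ _ _ => (hint i).integrableOn) (fun A hA _ => hset A hA hij)
    (Filtration.stronglyAdapted_natural (fun u => (hS u).stronglyMeasurable) i
      ).aestronglyMeasurable).symm

/-- `Q` is carried by the scenarios that agree with `ω` up to time `u`, and the prices are a
martingale under `Q` from time `u` on. -/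
structure IsMartingaleFrom (S : Fin (T + 1) → Ω → E d) (hS : ∀ u, Measurable (S u))
    (u : Fin (T + 1)) (ω : Ω) (Q : Measure Ω) : Prop where
  isProbabilityMeasure : IsProbabilityMeasure Q
  integrable : ∀ s, Integrable (S s) Q
  ae_eq : ∀ᵐ ω' ∂Q, ∀ s ≤ u, S s ω' = S s ω
  integral_eq_zero : ∀ t : Fin T, u ≤ t.castSucc → ∀ A : Set Ω,
    MeasurableSet[priceFiltration S hS t.castSucc] A → ∫ ω', A.indicator (increment S t) ω' ∂Q = 0

theorem IsMartingaleFrom.integral_indicator_increment {hS : ∀ u, Measurable (S u)} {t : Fin T}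
    {ω : Ω} {Q : Measure Ω} (hQ : IsMartingaleFrom S hS t.succ ω Q) {A : Set Ω}
    (hA : MeasurableSet[priceFiltration S hS t.castSucc] A) :
    ∫ ω', A.indicator (increment S t) ω' ∂Q = A.indicator (increment S t) ω := by
  have := hQ.isProbabilityMeasure
  have h : ∀ᵐ ω' ∂Q, A.indicator (increment S t) ω' = A.indicator (increment S t) ω := by
    filter_upwards [hQ.ae_eq] with ω' hω'
    have hmem : ω' ∈ A ↔ ω ∈ A := priceFiltration_le_indistinguishableSpace hS
      (fun s hs => hω' s (hs.trans Fin.castSucc_lt_succ.le)) A hA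
    have hinc : increment S t ω' = increment S t ω := by
      rw [increment, increment, hω' _ le_rfl, hω' _ Fin.castSucc_lt_succ.le]
    by_cases hω : ω ∈ A
    · rw [indicator_of_mem hω, indicator_of_mem (hmem.2 hω), hinc]
    · rw [indicator_of_notMem hω, indicator_of_notMem (mt hmem.1 hω)]
  rw [integral_congr_ae h]
  simp

/-- Backward pasting: finitely many successors with mean increment zero are chosen at the node, and
their measures are mixed with the same weights. Finiteness avoids measurable selection. -/
theorem exists_isMartingaleFrom [MeasurableSingletonClass Ω] (hv : IsSeparatorFamily v)
    (hS : ∀ u, Measurable (S u)) (u : Fin (T + 1)) :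
    ∀ ω ∈ efficientSet v S, ∃ Q, IsMartingaleFrom S hS u ω Q := by
  induction u using Fin.reverseInduction with
  | last =>
    refine fun ω _ => ⟨Measure.dirac ω, inferInstance, fun s => ?_, ?_, fun t ht => ?_⟩
    · exact integrable_dirac (by simp)
    · simp [ae_dirac_eq]
    · exact absurd ht (not_le.2 (Fin.castSucc_lt_last t))
  | cast t ih =>
    intro ω hω
    obtain ⟨ι, _, w, z, hw, hw1, hz, hsum⟩ :=
      mem_convexHull_iff_exists_fintype.1 (zero_mem_convexHull_efficientNode hv hω t)
    choose ω₁ hω₁ hz using hz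
    choose Q hQ using fun i => ih (ω₁ i) (hω₁ i).1
    have hQp := fun i => (hQ i).isProbabilityMeasure
    have hintegral : ∀ f : Ω → E d, (∀ i, Integrable f (Q i)) →
        ∫ ω', f ω' ∂(∑ i, ENNReal.ofReal (w i) • Q i) = ∑ i, w i • ∫ ω', f ω' ∂(Q i) := by
      intro f hf
      rw [integral_finsetSum_measure fun i _ => (hf i).smul_measure ENNReal.ofReal_ne_top]
      refine Finset.sum_congr rfl fun i _ => ?_
      rw [integral_smul_measure, ENNReal.toReal_ofReal (hw i)]
    have hinc : ∀ (s : Fin T) (A : Set Ω), MeasurableSet[priceFiltration S hS s.castSucc] A →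
        ∀ i, Integrable (A.indicator (increment S s)) (Q i) := fun s A hA i =>
      (((hQ i).integrable _).sub ((hQ i).integrable _)).indicator
        ((priceFiltration S hS).le _ _ hA)
    refine ⟨∑ i, ENNReal.ofReal (w i) • Q i, ⟨?_⟩, fun s => ?_, ?_, fun s hs A hA => ?_⟩
    · simp only [Measure.coe_finsetSum, Finset.sum_apply, Measure.smul_apply, measure_univ,
        smul_eq_mul, mul_one]
      rw [← ENNReal.ofReal_sum_of_nonneg fun i _ => hw i, hw1, ENNReal.ofReal_one]
    · exact integrable_finsetSum_measure.2 fun i _ =>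
        ((hQ i).integrable s).smul_measure ENNReal.ofReal_ne_top
    · rw [ae_iff, Measure.coe_finsetSum, Finset.sum_apply]
      refine Finset.sum_eq_zero fun i _ => ?_
      rw [Measure.smul_apply, smul_eq_mul, mul_eq_zero, ← ae_iff]
      right
      filter_upwards [(hQ i).ae_eq] with ω' hω' s hs
      exact (hω' s (hs.trans Fin.castSucc_lt_succ.le)).trans ((hω₁ i).2 s hs)
    · rw [hintegral _ (hinc s A hA)]
      rcases (Fin.castSucc_le_castSucc_iff.1 hs).eq_or_lt with rfl | hlt
      -- In the new period `A` contains all the successors or none, since they share the past of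
      -- `ω`.
      · have hmem : ∀ i, ω₁ i ∈ A ↔ ω ∈ A := fun i =>
          priceFiltration_le_indistinguishableSpace hS (hω₁ i).2 A hA
        by_cases hωA : ω ∈ A
        · rw [← hsum]
          refine Finset.sum_congr rfl fun i _ => ?_
          rw [(hQ i).integral_indicator_increment hA, indicator_of_mem ((hmem i).2 hωA), hz]
        · refine Finset.sum_eq_zero fun i _ => ?_
          rw [(hQ i).integral_indicator_increment hA, indicator_of_notMem (mt (hmem i).1 hωA),
            smul_zero]
      · refine Finset.sum_eq_zero fun i _ => ?_
        rw [(hQ i).integral_eq_zero s (Fin.succ_le_castSucc_iff.2 hlt) A hA, smul_zero]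

theorem martingaleMeasures_nonempty_of_efficientSet_nonempty [MeasurableSingletonClass Ω]
    (hv : IsSeparatorFamily v) (hS : ∀ u, Measurable (S u)) (h : (efficientSet v S).Nonempty) :
    (martingaleMeasures S hS).Nonempty := by
  obtain ⟨ω, hω⟩ := h
  obtain ⟨Q, hQ⟩ := exists_isMartingaleFrom hv hS 0 ω hω
  have := hQ.isProbabilityMeasure
  exact ⟨Q, mem_martingaleMeasures_of_setIntegral_increment_eq_zero hS hQ.integrable fun t A hA =>
    hQ.integral_eq_zero t (Fin.zero_le _) A hA⟩

/-- If the mean of the increment vanishes, then the eliminated points form a null set. -/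
theorem ae_mem_core_of_integral_increment_eq_zero (hv : IsSeparatorFamily v) {t : Fin T}
    {Γ : Set Ω} {κ : Measure Ω} (hint : Integrable (increment S t) κ)
    (hΓ : ∀ᵐ ω ∂κ, ω ∈ Γ) (h0 : ∫ ω, increment S t ω ∂κ = 0) :
    ∀ᵐ ω ∂κ, ω ∈ core v S t Γ := by
  refine core_induction (p := fun A => ∀ᵐ ω ∂κ, ω ∈ A) hΓ fun n hn ih => ?_
  have hri := zero_notMem_intrinsicInterior_of_lt hn
  -- The separator's gain is almost surely nonnegative with mean zero, hence almost surely zero, so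
  -- the next residual keeps full measure.
  have hzero : ∫ ω, inner ℝ (separator v S t Γ n) (increment S t ω) ∂κ = 0 := by
    rw [integral_inner hint, h0, inner_zero_right]
  have hnonneg : 0 ≤ᵐ[κ] fun ω => inner ℝ (separator v S t Γ n) (increment S t ω) := by
    filter_upwards [ih] with ω hω using separator_inner_nonneg hv hri hω
  filter_upwards [ih,
    (integral_eq_zero_iff_of_nonneg_ae hnonneg (hint.const_inner _)).1 hzero] with ω hω hω0
  exact (mem_residual_succ_iff hv hri).2 ⟨hω, hω0⟩

/-- The prices up to and including time `u`. -/
def pastPrices (S : Fin (T + 1) → Ω → E d) (u : Fin (T + 1)) (ω : Ω) : {s // s ≤ u} → E d :=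
  fun s => S s ω

theorem measurable_pastPrices (hS : ∀ u, Measurable (S u)) (u : Fin (T + 1)) :
    Measurable (pastPrices S u) :=
  measurable_pi_lambda _ fun s => hS s

theorem comap_pastPrices (hS : ∀ u, Measurable (S u)) (u : Fin (T + 1)) :
    MeasurableSpace.comap (pastPrices S u) inferInstance = priceFiltration S hS u := by
  change MeasurableSpace.comap (pastPrices S u)
    (⨆ s, MeasurableSpace.comap (fun x : {s // s ≤ u} → E d => x s) inferInstance) =
      ⨆ s, ⨆ _ : s ≤ u, MeasurableSpace.comap (S s) inferInstance
  simp only [MeasurableSpace.comap_iSup, MeasurableSpace.comap_comp, iSup_subtype]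
  rfl

/-- Disintegrate `Q` along past prices: almost every conditional law lives on the reduced level set
and has mean increment zero, so it charges the core, which is therefore nonempty. -/
theorem ae_isViable [StandardBorelSpace Ω] (hv : IsSeparatorFamily v)
    {hS : ∀ u, Measurable (S u)} {Q : Measure Ω} (hQ : Q ∈ martingaleMeasures S hS) {t : Fin T}
    (hsurv : ∀ᵐ ω ∂Q, ω ∈ survivors S t.succ) : ∀ᵐ ω ∂Q, IsViable S t ω := by
  obtain ⟨hprob, hmart⟩ := hQ
  have : Nonempty Ω := nonempty_of_isProbabilityMeasure Q
  set X := pastPrices S t.castSucc with hX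
  have hXm : Measurable X := measurable_pastPrices hS _
  have hint : Integrable (increment S t) Q :=
    (hmart.integrable _).sub (hmart.integrable _)
  have hcond : Q[increment S t | MeasurableSpace.comap X inferInstance] =ᵐ[Q] 0 := by
    rw [hX, comap_pastPrices hS]
    filter_upwards [condExp_sub (hmart.integrable t.succ) (hmart.integrable t.castSucc)
      (priceFiltration S hS t.castSucc), hmart.2 _ _ Fin.castSucc_lt_succ.le,
      hmart.2 _ _ (le_refl t.castSucc)] with ω h1 h2 h3
    exact h1.trans (by rw [Pi.sub_apply, h2, h3, sub_self, Pi.zero_apply])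
  have hprod : ∀ᵐ p ∂((Q.map X).compProd (ProbabilityTheory.condDistrib id X Q)),
      p.2 ∈ survivors S t.succ ∧ X p.2 = p.1 := by
    rw [ProbabilityTheory.compProd_map_condDistrib aemeasurable_id]
    -- The survivor set is not known to be measurable, so a measurable subset of full measure
    -- replaces it.
    obtain ⟨M, hM, hMm, hMsub⟩ := hsurv.exists_measurable_mem
    have hp : ∀ᵐ p ∂(Q.map fun ω => (X ω, id ω)), p.2 ∈ M ∧ X p.2 = p.1 := by
      refine (ae_map_iff (hXm.prodMk measurable_id).aemeasurable
        ((measurable_snd hMm).inter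
          (measurableSet_eq_fun (hXm.comp measurable_snd) measurable_fst))).2 ?_
      filter_upwards [hM] with ω hω using ⟨hω, rfl⟩
    filter_upwards [hp] with p hp using ⟨hMsub _ hp.1, hp.2⟩
  have hker := ae_of_ae_map hXm.aemeasurable (Measure.ae_ae_of_ae_compProd hprod)
  have hkint : ∀ᵐ ω ∂Q, Integrable (increment S t)
      (ProbabilityTheory.condDistrib id X Q (X ω)) :=
    Integrable.condDistrib_ae (f := fun p => increment S t p.2) hXm.aemeasurable aemeasurable_id
      (hint.comp_snd_map_prodMk X)
  filter_upwards [hcond, ProbabilityTheory.condExp_ae_eq_integral_condDistrib_id hXm hint,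
    hker, hkint] with ω h1 h2 h3 h4
  rw [h2] at h1
  rw [isViable_iff hv]
  refine (ae_mem_core_of_integral_increment_eq_zero hv h4 ?_ h1).exists
  filter_upwards [h3] with ω' hω'
  exact ⟨hω'.1, fun s hs => congrFun hω'.2 ⟨s, hs⟩⟩

/-- One survivor at time `0` is enough, as branching completes it. -/
theorem efficientSet_nonempty_of_martingaleMeasures_nonempty [StandardBorelSpace Ω]
    (hv : IsSeparatorFamily v) {hS : ∀ u, Measurable (S u)}
    (h : (martingaleMeasures S hS).Nonempty) : (efficientSet v S).Nonempty := by
  obtain ⟨Q, hQ⟩ := h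
  have hall : ∀ u, ∀ᵐ ω ∂Q, ω ∈ survivors S u := fun u => by
    induction u using Fin.reverseInduction with
    | last => simp [survivors_last]
    | cast t ih =>
      filter_upwards [ih, ae_isViable hv hQ ih] with ω h1 h2
      exact mem_survivors_castSucc.2 ⟨h1, h2⟩
  have := hQ.1
  obtain ⟨ω, hω⟩ := (hall 0).exists
  obtain ⟨ω', hω', -⟩ := exists_mem_efficientSet hv hω fun s hs => absurd hs (Fin.not_lt_zero _)
  exact ⟨ω', hω'⟩

end MartingaleMeasure

end RobustMarket

theorem mainTheorem10 {Ω : Type*} [TopologicalSpace Ω] [PolishSpace Ω] [MeasurableSpace Ω]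
    [BorelSpace Ω] {d T : ℕ} (S : Fin (T + 1) → Ω → RobustMarket.E d)
    (hS : ∀ u, Measurable (S u))
    (v : Set (RobustMarket.E d) → ℕ → RobustMarket.E d)
    (hv : RobustMarket.IsSeparatorFamily v) :
    (RobustMarket.gainSet S (RobustMarket.universalAggregator v S) =
        (⋃ H ∈ RobustMarket.nonnegStrategies v S hS, RobustMarket.gainSet S H) ∧
      (⋃ H ∈ RobustMarket.nonnegStrategies v S hS, RobustMarket.gainSet S H) =
        (RobustMarket.efficientSet v S)ᶜ) ∧
    ((RobustMarket.martingaleMeasures S hS).Nonempty ↔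
      (⋃ H ∈ RobustMarket.nonnegStrategies v S hS, RobustMarket.gainSet S H) ⊂ univ) := by
  rw [RobustMarket.iUnion_gainSet_nonnegStrategies hv hS,
    RobustMarket.gainSet_universalAggregator hv]
  refine ⟨⟨rfl, rfl⟩, ?_⟩
  rw [ssubset_univ_iff, Ne, compl_univ_iff, ← Ne, ← nonempty_iff_ne_empty]
  exact ⟨RobustMarket.efficientSet_nonempty_of_martingaleMeasures_nonempty hv,
    RobustMarket.martingaleMeasures_nonempty_of_efficientSet_nonempty hv hS⟩
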